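/- **Definitions.** A graph of type $3_n$ is a finite simple $3$-connected plane graph with exactly $n$ vertices in which every vertex has degree $3$ and every face is bounded by $3$ or by $6$ edges (equivalently, the skeleton of a $3$-valent convex polyhedron with $n$ vertices all of whose faces are triangles or hexagons). A railroad in a plane graph is a circuit of hexagonal faces in which each hexagon is adjacent to its two neighbours in the circuit on opposite edges; it may pass through the same hexagon more than once. A plane graph is tight if it has no railroad. **Theorem.** For every natural number $n$, there exists a tight graph of type $3_n$ if and only if $n/4$ is an odd integer. -/

import Mathlib

namespace PlaneGraph

/-- A rotation system on a simple graph `G`: a permutation of the darts (oriented edges) of `G`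
which, around every vertex `v`, is a single cyclic ordering of the darts that start at `v`.
Up to homeomorphism, the rotation systems on a connected graph are exactly its cellular drawings
on closed oriented surfaces (`rot` = next dart, in the orientation, around the start vertex). -/
structure RotationSystem {V : Type*} (G : SimpleGraph V) where
  /-- the next dart around the same start vertex -/
  rot : Equiv.Perm G.Dart
  /-- `rot` keeps the start vertex -/
  rot_fst : ∀ d : G.Dart, (rot d).fst = d.fst
  /-- all darts that start at one vertex lie in one cycle of `rot` -/
  sameCycle_of_fst_eq : ∀ d e : G.Dart, d.fst = e.fst → rot.SameCycle d e

/-- Reversal of darts. -/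
def dartRev {V : Type*} (G : SimpleGraph V) : Equiv.Perm G.Dart :=
  SimpleGraph.Dart.symm_involutive.toPerm

namespace RotationSystem

variable {V : Type*} {G : SimpleGraph V} (R : RotationSystem G)

/-- Face tracing: walk along the dart `d` to its end, and there leave along the next dart in the
rotation. The orbits of this permutation are the boundary walks of the faces; every dart lies on
the boundary of exactly one face (the face on one fixed side of it). -/
def faceNext : Equiv.Perm G.Dart := (dartRev G).trans R.rot

/-- The faces: the cycles of the face tracing permutation (of a graph that has an edge). -/
def Face : Type _ := Quotient (Equiv.Perm.SameCycle.setoid R.faceNext)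

/-- The number of edges of the face on whose boundary walk the dart `d` lies: the length of this
closed walk. -/
noncomputable def faceSize (d : G.Dart) : ℕ := Function.minimalPeriod R.faceNext d

/-- The rotation system is a drawing in the plane (equivalently, on the sphere): the graph is
connected and Euler's relation `#V - #E + #F = 2` says that the surface has genus zero. -/
def IsPlane : Prop :=
  G.Connected ∧ (Nat.card V : ℤ) - (Nat.card G.edgeSet : ℤ) + (Nat.card R.Face : ℤ) = 2

/-- In a face with six edges, the edge opposite to `d` on the boundary walk is three steps ahead.
This is the dart of this opposite edge that lies in the face on its other side, i.e. the dart
through which one arrives in the next face when one enters the hexagon of `d` through the edge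
of `d` and crosses it straight ahead. -/
def acrossHexagon (d : G.Dart) : G.Dart := (R.faceNext (R.faceNext (R.faceNext d))).symm

/-- A railroad: a circuit of hexagonal faces, indexed cyclically by `ZMod length`, in which every
hexagon is adjacent to its two neighbours on opposite edges. The `i`-th hexagon is recorded
by the dart `entry i` on its boundary, along which it is adjacent to the previous hexagon.
A hexagon may be met several times (the railroad may intersect itself), but a passage
through a hexagon is not repeated. -/
structure Railroad where
  /-- the number of passages through hexagons -/
  length : ℕ
  /-- a railroad is not empty -/
  length_pos : 0 < length
  /-- the dart through which the `i`-th hexagon is entered -/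
  entry : ZMod length → G.Dart
  /-- no passage is repeated -/
  entry_injective : Function.Injective entry
  /-- all faces of the circuit are hexagons -/
  hexagonal : ∀ i, R.faceSize (entry i) = 6
  /-- every hexagon is left through the edge opposite to the one through which it is entered -/
  entry_succ : ∀ i, entry (i + 1) = R.acrossHexagon (entry i)

/-- A plane graph is tight if it has no railroad. -/
def Tight : Prop := IsEmpty R.Railroad

end RotationSystem

/-- `G` is 3-connected: it has more than three vertices, and it stays connected whenever at most
two vertices are deleted. -/
def ThreeConnected {V : Type*} (G : SimpleGraph V) : Prop :=
  3 < Nat.card V ∧ ∀ S : Set V, S.ncard ≤ 2 → (G.induce Sᶜ).Connected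

/-- The plane graph `(G, R)` is of type `3_n`: it is (the skeleton of) a 3-valent polyhedron
with `n` vertices, i.e. a 3-connected plane graph, all of whose vertices have degree three,
and each of its faces has three or six edges. -/
structure IsType3 {V : Type*} [Finite V] {G : SimpleGraph V} (R : RotationSystem G) (n : ℕ) :
    Prop where
  card_vertices : Nat.card V = n
  plane : R.IsPlane
  threeConnected : ThreeConnected G
  threeValent : ∀ v : V, (G.neighborSet v).ncard = 3
  faceSize_eq : ∀ d : G.Dart, R.faceSize d = 3 ∨ R.faceSize d = 6

end PlaneGraph

namespace PlaneGraph

open Function Equiv.Perm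

/-! Let `s` be the reversal of darts and `φ` the face step. Valency 3 and face sizes 3, 6 give `s² =
φ⁶ = (φs)³ = 1`, so the rotation group of the hexagonal tiling acts on the darts. The translation
`sφ³` (straight across a hexagon) commutes with its conjugate by `φ`, whence an action of `ℤ²`. By
Euler's relation some dart `d` lies on a triangle, i.e. `φ³ d = d`. Let `L` be its stabilizer in
`ℤ²`. The darts form three copies of `ℤ²/L`, so `n = [ℤ² : L]` (`card_eq_three_mul_index`).

Since `φ³` acts by `u ↦ -u` around `d`, the translate of `d` by `u` lies on a triangle iff `2u ∈ L`.
No dart is its own reversal, which forces `L ⊆ 2ℤ²` (`even_of_mem_stabilizer`). Tightness says that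
every line in each of the three railroad directions meets `½L` (`exists_halving`). Hence `ℤ²/½L` is
generated by each of `x`, `y`, `y - x`, so its order `m` is odd, and `n = 4m` (`index_of_halving`).

Conversely, for odd `m` take the vertices `ℤ/m × (ℤ/2)²` and three colours of edges `x ↦ eᵢ - x`.
Any two colours form a Hamiltonian circuit, which yields 3-connectedness. The same cyclic order of
colours everywhere gives four triangles and otherwise hexagons. Going straight ahead moves the first
coordinate by a unit of `ℤ/m`, so every straight course runs into a triangle. -/

theorem iterate_eq_self_of_minimalPeriod_dvd {α : Type*} (f : Equiv.Perm α) {x : α} {n : ℕ} (h : minimalPeriod f x ∣ n) :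
    (f ^ n) x = x := by
  rw [← iterate_eq_pow]
  exact (isPeriodicPt_minimalPeriod f x).trans_dvd h

/-! ### Cycle lengths of a permutation. -/

section Cycles

variable {α : Type*} [Finite α] (f : Equiv.Perm α)

theorem minimalPeriod_eq_card_sameCycle (x : α) :
    minimalPeriod f x = Nat.card {y // f.SameCycle x y} := by
  classical
  have := Fintype.ofFinite (MulAction.orbit (Subgroup.zpowers f) x)
  have h := MulAction.minimalPeriod_eq_card f x
  rw [← Nat.card_eq_fintype_card] at h
  refine h.trans (Nat.card_congr (Equiv.subtypeEquivRight fun y => ?_))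
  rw [MulAction.mem_orbit_iff]
  constructor
  · rintro ⟨⟨_, k, rfl⟩, rfl⟩
    exact ⟨k, rfl⟩
  · rintro ⟨k, rfl⟩
    exact ⟨⟨f ^ k, k, rfl⟩, rfl⟩

theorem minimalPeriod_perm_pos (x : α) : 0 < minimalPeriod f x := by
  rw [minimalPeriod_eq_card_sameCycle]
  have : Nonempty {y // f.SameCycle x y} := ⟨⟨x, SameCycle.refl f x⟩⟩
  exact Nat.card_pos

theorem minimalPeriod_eq_of_sameCycle {x y : α} (h : f.SameCycle x y) :
    minimalPeriod f x = minimalPeriod f y := by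
  simp only [minimalPeriod_eq_card_sameCycle]
  exact Nat.card_congr (Equiv.subtypeEquivRight fun z =>
    ⟨fun hz => h.symm.trans hz, fun hz => h.trans hz⟩)

/-- A cycle of length `l` contributes `l · (1/l) = 1`. This counts faces from the face sizes at the
darts. -/
theorem sum_inv_minimalPeriod [Fintype α] :
    ∑ x, (1 / minimalPeriod f x : ℚ) = Nat.card (Quotient (SameCycle.setoid f)) := by
  classical
  have := Fintype.ofFinite (Quotient (SameCycle.setoid f))
  rw [← Finset.sum_fiberwise Finset.univ (fun x => (Quotient.mk (SameCycle.setoid f) x)),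
    Nat.card_eq_fintype_card, ← Finset.card_univ, Finset.cast_card]
  refine Finset.sum_congr rfl fun q _ => ?_
  induction q using Quotient.inductionOn with
  | h x =>
  have hmem : ∀ y, y ∈ Finset.univ.filter
      (fun y => Quotient.mk (SameCycle.setoid f) y = Quotient.mk (SameCycle.setoid f) x) ↔
      f.SameCycle x y := fun y => by
    simp only [Finset.mem_filter, Finset.mem_univ, true_and]
    rw [Quotient.eq]
    exact sameCycle_comm
  rw [Finset.sum_congr rfl fun y hy => by
      rw [← minimalPeriod_eq_of_sameCycle f ((hmem y).1 hy)], Finset.sum_const,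
    nsmul_eq_mul, minimalPeriod_eq_card_sameCycle, Nat.card_congr (Equiv.subtypeEquivRight fun y => (hmem y).symm), Nat.card_eq_fintype_card, Fintype.card_coe]
  refine mul_one_div_cancel (Nat.cast_ne_zero.2 (Finset.card_ne_zero_of_mem (a := x) ?_))
  exact (hmem x).2 (SameCycle.refl f x)

end Cycles

/-! ### Counting darts. -/

section Darts

variable {V : Type*} {G : SimpleGraph V}

theorem card_dart_fst (v : V) :
    Nat.card {d : G.Dart // d.fst = v} = (G.neighborSet v).ncard := by
  rw [← Nat.card_coe_set_eq]
  exact Nat.card_congr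
    { toFun := fun d => ⟨d.1.snd, (congrArg (G.Adj · d.1.snd) d.2).mp d.1.adj⟩
      invFun := fun w => ⟨⟨(v, w.1), w.2⟩, rfl⟩
      left_inv := by
        rintro ⟨⟨⟨a, b⟩, hab⟩, rfl⟩
        rfl
      right_inv := fun w => rfl }

variable [Finite V]

instance : Finite G.Dart := Finite.of_injective _ SimpleGraph.Dart.toProd_injective

theorem card_dart_of_threeValent (h : ∀ v : V, (G.neighborSet v).ncard = 3) :
    Nat.card G.Dart = 3 * Nat.card V := by
  have := Fintype.ofFinite V
  rw [Nat.card_congr (Equiv.sigmaFiberEquiv (fun d : G.Dart => d.fst)).symm, Nat.card_sigma]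
  simp [card_dart_fst, h, mul_comm]

theorem card_dart_eq_two_mul_card_edgeSet : Nat.card G.Dart = 2 * Nat.card G.edgeSet := by
  classical
  have := Fintype.ofFinite V
  have h := G.dart_card_eq_twice_card_edges
  rw [Nat.card_eq_fintype_card, h, Nat.card_eq_fintype_card, SimpleGraph.edgeFinset_card]

theorem RotationSystem.sum_inv_faceSize [Fintype G.Dart] (R : RotationSystem G) :
    ∑ d, (1 / R.faceSize d : ℚ) = Nat.card R.Face :=
  sum_inv_minimalPeriod R.faceNext

end Darts

/-! ### The index of the stabilizer lattice. -/

/-- The group is cyclic with `y = u • x`. If its order were even, generators would be odd multiples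
of `x`, so both `u` and `u - 1` would be odd. -/
theorem odd_card_of_generators {P : Type*} [AddCommGroup P] [Finite P] (x y : P)
    (hx : ∀ z, ∃ k : ℤ, z = k • x) (hy : ∀ z, ∃ k : ℤ, z = k • y)
    (hyx : ∀ z, ∃ k : ℤ, z = k • (y - x)) : Odd (Nat.card P) := by
  have hord : addOrderOf x = Nat.card P :=
    addOrderOf_eq_card_of_forall_mem_zmultiples fun z =>
      AddSubgroup.mem_zmultiples_iff.2 ((hx z).imp fun _ h => h.symm)
  by_contra heven
  rw [Nat.not_odd_iff_even, ← hord, even_iff_two_dvd] at heven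
  obtain ⟨u, hu⟩ := hx y
  obtain ⟨k, hk⟩ := hy x
  obtain ⟨l, hl⟩ := hyx x
  have key : ∀ i : ℤ, i • x = 0 → (2 : ℤ) ∣ i := fun i hi =>
    (Int.natCast_dvd_natCast.2 heven).trans (addOrderOf_dvd_iff_zsmul_eq_zero.2 hi)
  have h1 : (2 : ℤ) ∣ k * u - 1 := key _ (by
    rw [sub_smul, mul_smul, ← hu, ← hk, one_smul, sub_self])
  have h2 : (2 : ℤ) ∣ l * (u - 1) - 1 := key _ (by
    rw [sub_smul, mul_smul, sub_smul, ← hu, one_smul, ← hl, sub_self])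
  have h3 : Odd (k * u) := by
    rw [← Int.not_even_iff_odd, even_iff_two_dvd]
    omega
  have h4 : Odd (l * (u - 1)) := by
    rw [← Int.not_even_iff_odd, even_iff_two_dvd]
    omega
  have h5 := (Int.odd_mul.1 h3).2
  have h6 := (Int.odd_mul.1 h4).2
  rw [← Int.not_even_iff_odd, even_iff_two_dvd] at h5 h6
  omega

/-- A sublattice of the lattice `2ℤ²`, in which every point of `ℤ²` can be moved along each of the
three directions `(1, 0)`, `(0, 1)`, `(-1, 1)` to a half of a point of the sublattice. -/
theorem index_of_halving (L : AddSubgroup (ℤ × ℤ)) [L.FiniteIndex]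
    (heven : ∀ p ∈ L, Even p.1 ∧ Even p.2)
    (h₁ : ∀ u : ℤ × ℤ, ∃ k : ℤ, (2 : ℤ) • (u - k • ((1, 0) : ℤ × ℤ)) ∈ L)
    (h₂ : ∀ u : ℤ × ℤ, ∃ k : ℤ, (2 : ℤ) • (u - k • ((0, 1) : ℤ × ℤ)) ∈ L)
    (h₃ : ∀ u : ℤ × ℤ, ∃ k : ℤ, (2 : ℤ) • (u - k • ((-1, 1) : ℤ × ℤ)) ∈ L) :
    ∃ m, Odd m ∧ L.index = 4 * m := by
  let D : (ℤ × ℤ) →+ (ℤ × ℤ) := zsmulAddGroupHom 2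
  have hD : ∀ p, D p = (2 : ℤ) • p := fun p => rfl
  have hinj : Function.Injective D := fun p q h => by
    simp only [hD] at h
    exact smul_right_injective _ (two_ne_zero) h
  have hrange : D.range.index = 4 := by
    let E : (ℤ × ℤ) →+ (ZMod 2 × ZMod 2) :=
      (Int.castAddHom (ZMod 2)).prodMap (Int.castAddHom (ZMod 2))
    have hE : D.range = E.ker := by
      ext ⟨i, j⟩
      rw [AddMonoidHom.mem_ker, AddMonoidHom.mem_range]
      have : E (i, j) = 0 ↔ (2 : ℤ) ∣ i ∧ (2 : ℤ) ∣ j := by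
        exact Prod.ext_iff.trans (and_congr (ZMod.intCast_zmod_eq_zero_iff_dvd i 2)
          (ZMod.intCast_zmod_eq_zero_iff_dvd j 2))
      rw [this]
      constructor
      · rintro ⟨⟨k, l⟩, h⟩
        rw [hD, Prod.ext_iff] at h
        exact ⟨⟨k, h.1.symm⟩, ⟨l, h.2.symm⟩⟩
      · rintro ⟨⟨k, rfl⟩, ⟨l, rfl⟩⟩
        exact ⟨(k, l), rfl⟩
    have hsurj : Function.Surjective E :=
      Prod.map_surjective.2 ⟨ZMod.intCast_surjective, ZMod.intCast_surjective⟩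
    rw [hE, AddSubgroup.index_ker, AddMonoidHom.range_eq_top.2 hsurj, AddSubgroup.card_top]
    simp
  -- This is `½L`. As `L ⊆ 2ℤ²`, doubling maps it onto `L`, which accounts for the factor 4.
  let M := L.comap D
  have hML : M.map D = L := by
    refine AddSubgroup.map_comap_eq_self fun p hp => ?_
    obtain ⟨⟨i, hi⟩, ⟨j, hj⟩⟩ := heven p hp
    exact ⟨(i, j), Prod.ext (by simp [hD, hi, two_mul]) (by simp [hD, hj, two_mul])⟩
  have hindex : L.index = M.index * 4 := by
    rw [← hrange, ← AddSubgroup.index_map_of_injective M hinj, hML]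
  have hM : M.index ≠ 0 := fun h => by
    rw [h, zero_mul] at hindex
    exact AddSubgroup.FiniteIndex.index_ne_zero hindex
  have : Finite ((ℤ × ℤ) ⧸ M) := Nat.finite_of_card_ne_zero hM
  have hgen : ∀ e : ℤ × ℤ, (∀ u : ℤ × ℤ, ∃ k : ℤ, (2 : ℤ) • (u - k • e) ∈ L) →
      ∀ z : (ℤ × ℤ) ⧸ M, ∃ k : ℤ, z = k • (QuotientAddGroup.mk e : (ℤ × ℤ) ⧸ M) := by
    intro e he z
    obtain ⟨u, rfl⟩ := QuotientAddGroup.mk_surjective z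
    obtain ⟨k, hk⟩ := he u
    refine ⟨k, ?_⟩
    rw [← QuotientAddGroup.mk_zsmul, QuotientAddGroup.eq_iff_sub_mem]
    exact hk
  refine ⟨M.index, ?_, by rw [hindex, mul_comm]⟩
  refine odd_card_of_generators (P := (ℤ × ℤ) ⧸ M) (QuotientAddGroup.mk (1, 0))
    (QuotientAddGroup.mk (0, 1)) (hgen _ h₁) (hgen _ h₂) ?_
  rw [← QuotientAddGroup.mk_sub]
  exact hgen _ (by simpa using h₃)

/-! ### Translations in the rotation group of the hexagonal tiling. -/

/-- The product `a ^ i * b ^ j` attached to the lattice vector `(i, j)`. -/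
def latticePow {Γ : Type*} [Group Γ] (a b : Γ) (p : ℤ × ℤ) : Γ := a ^ p.1 * b ^ p.2

theorem latticePow_add {Γ : Type*} [Group Γ] {a b : Γ} (h : Commute a b) (p q : ℤ × ℤ) :
    latticePow a b (p + q) = latticePow a b p * latticePow a b q := by
  have := (h.zpow_zpow q.1 p.2).eq
  simp only [latticePow, Prod.fst_add, Prod.snd_add, zpow_add]
  simp only [mul_assoc]
  rw [← mul_assoc (b ^ p.2), ← this]
  simp only [mul_assoc]

theorem latticePow_zsmul {Γ : Type*} [Group Γ] {a b : Γ} (h : Commute a b) (k : ℤ) (p : ℤ × ℤ) :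
    latticePow a b (k • p) = latticePow a b p ^ k := by
  simp only [latticePow, Prod.smul_fst, Prod.smul_snd, smul_eq_mul]
  rw [((h.zpow_zpow p.1 p.2)).mul_zpow, ← zpow_mul, ← zpow_mul, mul_comm k, mul_comm k]

theorem latticePow_zero {Γ : Type*} [Group Γ] (a b : Γ) : latticePow a b 0 = 1 := by
  simp [latticePow]

/-- Three relations in the rotation group of the hexagonal tiling. -/
structure HexagonalRelations {Γ : Type*} [Group Γ] (s φ : Γ) : Prop where
  rev_sq : s * s = 1
  face_pow : φ ^ 6 = 1
  vertex_pow : (φ * s) ^ 3 = 1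

namespace HexagonalRelations

variable {Γ : Type*} [Group Γ] {s φ : Γ}

theorem face_pow_three_inv (h : HexagonalRelations s φ) : (φ ^ 3)⁻¹ = φ ^ 3 := by
  rw [inv_eq_iff_mul_eq_one, ← pow_add]
  exact h.face_pow

theorem rev_inv (h : HexagonalRelations s φ) : s⁻¹ = s := inv_eq_iff_mul_eq_one.2 h.rev_sq

/-- With `a = sφ³` and its conjugates by `φ`, `φ²` as unit vectors at successive angles of 60°, this
is the relation that the third plus the first equals the second. -/
theorem translation_two (h : HexagonalRelations s φ) : φ ^ 2 * (s * φ ^ 3) * (φ ^ 2)⁻¹ * (s * φ ^ 3) =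
    φ * (s * φ ^ 3) * φ⁻¹ := by
  have h1 : φ * s * φ * s * φ = s := by
    have := h.vertex_pow
    rw [pow_succ, pow_two, ← mul_assoc, mul_eq_one_iff_eq_inv, h.rev_inv] at this
    simpa only [mul_assoc] using this
  calc _ = φ * (φ * s * φ * s * φ) * φ ^ 2 := by
        simp [pow_succ, mul_assoc]
    _ = φ * s * φ ^ 2 := by rw [h1]
    _ = _ := by simp [pow_succ, mul_assoc]

theorem conj_three (h : HexagonalRelations s φ) : φ ^ 3 * (s * φ ^ 3) * (φ ^ 3)⁻¹ = (s * φ ^ 3)⁻¹ := by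
  rw [mul_inv_rev, h.face_pow_three_inv, h.rev_inv]
  rw [mul_assoc, mul_assoc, ← pow_add, h.face_pow, mul_one]

theorem conj_face_face (h : HexagonalRelations s φ) : φ * (φ * (s * φ ^ 3) * φ⁻¹) * φ⁻¹ =
    φ * (s * φ ^ 3) * φ⁻¹ * (s * φ ^ 3)⁻¹ := by
  rw [eq_mul_inv_iff_mul_eq]
  refine Eq.trans ?_ h.translation_two
  simp [pow_succ, mul_assoc]

theorem commute (h : HexagonalRelations s φ) : Commute (s * φ ^ 3) (φ * (s * φ ^ 3) * φ⁻¹) := by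
  have h0 := h.conj_three
  have h1 := h.conj_face_face
  generalize s * φ ^ 3 = a at h0 h1 ⊢
  generalize hb : φ * a * φ⁻¹ = b at h1 ⊢
  -- Conjugation by `φ³` inverts `a`. Computing the same conjugate from `φbφ⁻¹ = ba⁻¹` gives
  -- `ba⁻¹b⁻¹`, so `a` and `b` commute.
  have h2 : φ * (φ * b * φ⁻¹) * φ⁻¹ = a⁻¹ := by
    rw [← hb, ← h0]
    simp [pow_succ, mul_assoc]
  have h3 : φ * (b * a⁻¹) * φ⁻¹ = (φ * b * φ⁻¹) * (φ * a * φ⁻¹)⁻¹ := by group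
  rw [h1, h3, h1, hb, mul_inv_eq_iff_eq_mul] at h2
  rw [commute_iff_eq]
  rw [mul_inv_eq_iff_eq_mul] at h2
  calc a * b = a * (a⁻¹ * b * a) := by rw [← h2]
    _ = b * a := by group

theorem face_mul_latticePow (h : HexagonalRelations s φ) (p : ℤ × ℤ) :
    φ * latticePow (s * φ ^ 3) (φ * (s * φ ^ 3) * φ⁻¹) p =
      latticePow (s * φ ^ 3) (φ * (s * φ ^ 3) * φ⁻¹) (-p.2, p.1 + p.2) * φ := by
  have h1 := h.conj_face_face
  have hc := h.commute
  generalize s * φ ^ 3 = a at h1 hc ⊢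
  generalize hb : φ * a * φ⁻¹ = b at h1 hc ⊢
  rw [← mul_inv_eq_iff_eq_mul]
  simp only [latticePow]
  calc φ * (a ^ p.1 * b ^ p.2) * φ⁻¹ = (φ * a * φ⁻¹) ^ p.1 * (φ * b * φ⁻¹) ^ p.2 := by
        rw [conj_zpow, conj_zpow]
        simp [mul_assoc]
    _ = b ^ p.1 * (b * a⁻¹) ^ p.2 := by rw [hb, h1]
    _ = b ^ p.1 * (b ^ p.2 * a ^ (-p.2)) := by
        rw [hc.symm.inv_right.mul_zpow, inv_zpow, zpow_neg]
    _ = a ^ (-p.2) * b ^ (p.1 + p.2) := by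
        rw [← mul_assoc, ← zpow_add, (hc.zpow_zpow _ _).eq]

theorem face_pow_three_mul_latticePow (h : HexagonalRelations s φ) (p : ℤ × ℤ) :
    φ ^ 3 * latticePow (s * φ ^ 3) (φ * (s * φ ^ 3) * φ⁻¹) p =
      latticePow (s * φ ^ 3) (φ * (s * φ ^ 3) * φ⁻¹) (-p) * φ ^ 3 := by
  have h1 := h.face_mul_latticePow
  calc _ = φ * (φ * (φ * latticePow (s * φ ^ 3) (φ * (s * φ ^ 3) * φ⁻¹) p)) := by
        simp only [pow_succ, pow_zero, one_mul, mul_assoc]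
    _ = _ := by
        rw [h1, ← mul_assoc φ (latticePow _ _ _), h1, mul_assoc, ← mul_assoc φ (latticePow _ _ _),
          h1]
        simp only [pow_succ, pow_zero, one_mul, mul_assoc]
        congr 2
        ext <;> simp

end HexagonalRelations

/-! ### The lattice action on the darts. -/

namespace HexagonalRelations

variable {D : Type*} {s φ : Equiv.Perm D}

/-- The translation of the darts by a lattice vector. -/
def translate (s φ : Equiv.Perm D) (p : ℤ × ℤ) : Equiv.Perm D :=
  latticePow (s * φ ^ 3) (φ * (s * φ ^ 3) * φ⁻¹) p

theorem translate_add (h : HexagonalRelations s φ) (p q : ℤ × ℤ) (d : D) :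
    translate s φ (p + q) d = translate s φ p (translate s φ q d) :=
  congrArg (· d) (latticePow_add h.commute p q)

theorem translate_zero (d : D) : translate s φ 0 d = d := by
  rw [translate, latticePow_zero, one_apply]

theorem translate_zsmul (h : HexagonalRelations s φ) (k : ℤ) (p : ℤ × ℤ) (d : D) :
    translate s φ (k • p) d = (translate s φ p ^ k) d :=
  congrArg (· d) (latticePow_zsmul h.commute k p)

theorem face_translate (h : HexagonalRelations s φ) (p : ℤ × ℤ) (d : D) :
    φ (translate s φ p d) = translate s φ (-p.2, p.1 + p.2) (φ d) :=
  congrArg (· d) (h.face_mul_latticePow p)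

theorem face_pow_three_translate (h : HexagonalRelations s φ) (p : ℤ × ℤ) (d : D) :
    (φ ^ 3) (translate s φ p d) = translate s φ (-p) ((φ ^ 3) d) :=
  congrArg (· d) (h.face_pow_three_mul_latticePow p)

theorem translate_one_zero : translate s φ (1, 0) = φ ^ 0 * (s * φ ^ 3) * (φ ^ 0)⁻¹ := by
  simp [translate, latticePow]

theorem translate_zero_one : translate s φ (0, 1) = φ ^ 1 * (s * φ ^ 3) * (φ ^ 1)⁻¹ := by
  simp [translate, latticePow]

theorem translate_neg_one_one (h : HexagonalRelations s φ) :
    translate s φ (-1, 1) = φ ^ 2 * (s * φ ^ 3) * (φ ^ 2)⁻¹ := by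
  have h1 := h.commute
  have h2 := h.conj_face_face
  have h3 : φ ^ 2 * (s * φ ^ 3) * (φ ^ 2)⁻¹ = φ * (φ * (s * φ ^ 3) * φ⁻¹) * φ⁻¹ := by
    simp only [pow_two, mul_inv_rev, mul_assoc]
  rw [h3, h2, translate, latticePow]
  simp only [zpow_neg, zpow_one]
  exact h1.inv_left.eq

/-- The lattice vectors whose translations fix a given dart. -/
def stabilizer (h : HexagonalRelations s φ) (d : D) : AddSubgroup (ℤ × ℤ) where
  carrier := {p | translate s φ p d = d}
  zero_mem' := translate_zero d
  add_mem' := fun {p q} hp hq => by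
    simp only [Set.mem_ofPred_eq] at hp hq ⊢
    rw [h.translate_add, hq, hp]
  neg_mem' := fun {p} hp => by
    simp only [Set.mem_ofPred_eq] at hp ⊢
    conv_lhs => rw [← hp]
    rw [← h.translate_add, neg_add_cancel, translate_zero]

theorem mem_stabilizer (h : HexagonalRelations s φ) {d : D} {p : ℤ × ℤ} :
    p ∈ h.stabilizer d ↔ translate s φ p d = d := Iff.rfl

theorem translate_eq_iff (h : HexagonalRelations s φ) {d : D} {p q : ℤ × ℤ} :
    translate s φ p d = translate s φ q d ↔ q - p ∈ h.stabilizer d := by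
  rw [mem_stabilizer, ← (translate s φ p).apply_eq_iff_eq (x := translate s φ (q - p) d),
    ← h.translate_add, add_sub_cancel, eq_comm]

variable {d : D}

theorem rev_eq (h : HexagonalRelations s φ) (e : D) : s e = translate s φ (1, 0) ((φ ^ 3) e) := by
  rw [translate_one_zero]
  have : s = s * φ ^ 3 * φ ^ 3 := by rw [mul_assoc, ← pow_add, h.face_pow, mul_one]
  conv_lhs => rw [this]
  simp

theorem exists_face_pow_translate (h : HexagonalRelations s φ) (hd : (φ ^ 3) d = d)
    (htrans : ∀ P : D → Prop, P d → (∀ e, P e → P (φ e)) → (∀ e, P e → P (s e)) → ∀ e, P e)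
    (e : D) : ∃ (k : Fin 3) (p : ℤ × ℤ), e = translate s φ p ((φ ^ (k : ℕ)) d) := by
  have hpow : ∀ k : ℕ, (φ ^ (k % 3)) d = (φ ^ k) d := fun k => by
    conv_rhs => rw [← Nat.mod_add_div k 3, pow_add, pow_mul, mul_apply,
      Equiv.Perm.pow_apply_eq_self_of_apply_eq_self hd]
  suffices h' : ∃ (k : ℕ) (p : ℤ × ℤ), e = translate s φ p ((φ ^ k) d) by
    obtain ⟨k, p, rfl⟩ := h'
    exact ⟨⟨k % 3, Nat.mod_lt _ three_pos⟩, p, by rw [hpow]⟩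
  have hface : ∀ e, (∃ (k : ℕ) (p : ℤ × ℤ), e = translate s φ p ((φ ^ k) d)) →
      ∃ (k : ℕ) (p : ℤ × ℤ), φ e = translate s φ p ((φ ^ k) d) := by
    rintro _ ⟨k, p, rfl⟩
    exact ⟨k + 1, _, by rw [h.face_translate, pow_succ', mul_apply]⟩
  revert e
  refine htrans _ ⟨0, 0, (translate_zero _).symm⟩ hface ?_
  intro e he
  obtain ⟨k, p, hp⟩ := hface _ (hface _ (hface _ he))
  refine ⟨k, (1, 0) + p, ?_⟩
  rw [h.rev_eq, h.translate_add, ← hp]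
  rfl

/-- For the lattice rotation `R` of order six, `1 - R` has determinant 1. If `φ d` were the
translate of `d` by `p`, then `q = Rq + p` would have an integral solution, and the translate of `d`
by `q` would be fixed by `φ`. -/
theorem face_ne_translate (h : HexagonalRelations s φ) (hφ : ∀ e, φ e ≠ e) (p : ℤ × ℤ) :
    φ d ≠ translate s φ p d := by
  intro hp
  refine hφ (translate s φ (-p.2, p.1 + p.2) d) ?_
  rw [h.face_translate, hp, ← h.translate_add]
  congr 2
  ext <;> simp

theorem face_sq_ne_translate (h : HexagonalRelations s φ) (hφ : ∀ e, φ e ≠ e)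
    (hd : (φ ^ 3) d = d) (p : ℤ × ℤ) : (φ ^ 2) d ≠ translate s φ p d := by
  intro hp
  have h1 : φ ((φ ^ 2) d) = d := hd
  rw [hp, h.face_translate] at h1
  refine h.face_ne_translate hφ (d := d) (-(-p.2, p.1 + p.2)) ?_
  conv_rhs => rw [← h1]
  rw [← h.translate_add, neg_add_cancel, translate_zero]

theorem face_pow_eq_translate (h : HexagonalRelations s φ) (hφ : ∀ e, φ e ≠ e)
    (hd : (φ ^ 3) d = d) {k l : ℕ} (hkl : k ≤ l) (hl : l < 3) {p q : ℤ × ℤ}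
    (heq : (φ ^ k) (translate s φ p d) = (φ ^ l) (translate s φ q d)) : k = l := by
  obtain ⟨j, rfl⟩ := Nat.exists_eq_add_of_le hkl
  rw [pow_add, mul_apply, EmbeddingLike.apply_eq_iff_eq] at heq
  have h0 : ∀ (u r : ℤ × ℤ) (e : D), translate s φ u d = translate s φ r e →
      e = translate s φ (-r + u) d := fun u r e hu => by
    rw [h.translate_add, hu, ← h.translate_add, neg_add_cancel, translate_zero]
  match j, hl with
  | 0, _ => rfl
  | 1, _ =>
    rw [pow_one, h.face_translate] at heq
    exact absurd (h0 _ _ _ heq) (h.face_ne_translate hφ _)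
  | 2, _ =>
    rw [pow_two, mul_apply, h.face_translate, h.face_translate] at heq
    exact absurd (h0 _ _ _ heq) (h.face_sq_ne_translate hφ hd _)
  | j + 3, hl => omega

theorem card_eq_three_mul_index (h : HexagonalRelations s φ) (hd : (φ ^ 3) d = d)
    (hφ : ∀ e, φ e ≠ e)
    (htrans : ∀ P : D → Prop, P d → (∀ e, P e → P (φ e)) → (∀ e, P e → P (s e)) → ∀ e, P e) :
    Nat.card D = 3 * (h.stabilizer d).index := by
  let F : Fin 3 × ((ℤ × ℤ) ⧸ h.stabilizer d) → D := fun x =>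
    (φ ^ (x.1 : ℕ)) (Quotient.liftOn' x.2 (fun p => translate s φ p d) fun p q hpq => by
      rw [QuotientAddGroup.leftRel_apply] at hpq
      rw [h.translate_eq_iff, sub_eq_neg_add]
      exact hpq)
  have hF : ∀ k p, F (k, QuotientAddGroup.mk p) = (φ ^ (k : ℕ)) (translate s φ p d) :=
    fun k p => rfl
  have hinj : Function.Injective F := by
    rintro ⟨k, x⟩ ⟨l, y⟩ hxy
    obtain ⟨p, rfl⟩ := QuotientAddGroup.mk_surjective x
    obtain ⟨q, rfl⟩ := QuotientAddGroup.mk_surjective y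
    rw [hF, hF] at hxy
    have hkl : (k : ℕ) = l := by
      rcases le_total (k : ℕ) l with hle | hle
      · exact h.face_pow_eq_translate hφ hd hle l.2 hxy
      · exact (h.face_pow_eq_translate hφ hd hle k.2 hxy.symm).symm
    obtain rfl := Fin.ext hkl
    rw [EmbeddingLike.apply_eq_iff_eq, h.translate_eq_iff, sub_eq_neg_add] at hxy
    rw [QuotientAddGroup.eq.2 hxy]
  have hsurj : Function.Surjective F := fun e => by
    have hk : ∀ (k : ℕ) (p : ℤ × ℤ), ∃ q, translate s φ p ((φ ^ k) d) =
        (φ ^ k) (translate s φ q d) := by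
      intro k
      induction k with
      | zero => exact fun p => ⟨p, rfl⟩
      | succ k ih =>
        intro p
        -- The preimage of `p` under the lattice rotation `(x, y) ↦ (-y, x + y)`.
        obtain ⟨q, hq⟩ := ih (p.1 + p.2, -p.1)
        refine ⟨q, ?_⟩
        rw [pow_succ', mul_apply, mul_apply, ← hq, h.face_translate]
        congr 2
        ext <;> simp
    obtain ⟨k, p, rfl⟩ := h.exists_face_pow_translate hd htrans e
    obtain ⟨q, hq⟩ := hk k p
    exact ⟨(k, QuotientAddGroup.mk q), by rw [hF, hq]⟩
  rw [← Nat.card_congr (Equiv.ofBijective F ⟨hinj, hsurj⟩), Nat.card_prod, Nat.card_fin]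
  rfl

/-- Translation by `v` after the half turn `φ³` is a conjugate of `s`, so it fixes no dart; but it
would fix the translate of `d` by `u` if `2u - v` were in the stabilizer. -/
theorem two_zsmul_sub_notMem (h : HexagonalRelations s φ) (hd : (φ ^ 3) d = d)
    (hs : ∀ e, s e ≠ e) {v : ℤ × ℤ} {j : ℕ}
    (hv : translate s φ v = φ ^ j * (s * φ ^ 3) * (φ ^ j)⁻¹) (u : ℤ × ℤ) :
    (2 : ℤ) • u - v ∉ h.stabilizer d := by
  intro hu
  have h1 : translate s φ v * φ ^ 3 = φ ^ j * s * (φ ^ j)⁻¹ := by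
    calc _ = φ ^ j * s * (φ ^ 3 * (φ ^ j)⁻¹ * φ ^ 3) := by rw [hv]; simp only [mul_assoc]
      _ = φ ^ j * s * ((φ ^ j)⁻¹ * φ ^ 6) := by
        rw [((Commute.refl φ).pow_pow 3 j).inv_right.eq, mul_assoc ((φ ^ j)⁻¹), ← pow_add]
      _ = _ := by rw [h.face_pow, mul_one]
  have h2 : translate s φ v ((φ ^ 3) (translate s φ u d)) = translate s φ u d := by
    rw [h.face_pow_three_translate, hd, ← h.translate_add, h.translate_eq_iff]
    convert hu using 1
    rw [two_zsmul]
    abel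
  rw [← mul_apply, h1, mul_apply, mul_apply, ← eq_inv_iff_eq] at h2
  exact hs _ h2

theorem even_of_mem_stabilizer (h : HexagonalRelations s φ) (hd : (φ ^ 3) d = d)
    (hs : ∀ e, s e ≠ e) {p : ℤ × ℤ} (hp : p ∈ h.stabilizer d) : Even p.1 ∧ Even p.2 := by
  obtain ⟨i, j⟩ := p
  have key : ∀ (v : ℤ × ℤ) (k : ℕ), translate s φ v = φ ^ k * (s * φ ^ 3) * (φ ^ k)⁻¹ →
      ∀ u : ℤ × ℤ, (i, j) ≠ (2 : ℤ) • u - v := fun v k hv u hu =>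
    h.two_zsmul_sub_notMem hd hs hv u (hu ▸ hp)
  -- The three nonzero classes modulo 2 are those of the three directions `(0, 1)`, `(1, 0)`, `(-1,
  -- 1)`.
  rcases Int.even_or_odd' i with ⟨x, rfl | rfl⟩ <;> rcases Int.even_or_odd' j with ⟨y, rfl | rfl⟩
  · exact ⟨even_two_mul x, even_two_mul y⟩
  · exact absurd (Prod.ext (by simp) (by simp; ring)) (key _ _ translate_zero_one (x, y + 1))
  · exact absurd (Prod.ext (by simp; ring) (by simp)) (key _ _ translate_one_zero (x + 1, y))
  · exact absurd (Prod.ext (by simp) (by simp; ring))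
      (key _ _ h.translate_neg_one_one (x, y + 1))

/-- Conjugation by `φ ^ j` turns the translation `sφ³` into translation by `v`. A dart on this line
fixed by `φ³` is a translate of `d` by some `w` with `2w` in the stabilizer. -/
theorem exists_halving (h : HexagonalRelations s φ) (hd : (φ ^ 3) d = d)
    (htight : ∀ e, ∃ k : ℤ, (φ ^ 3) (((s * φ ^ 3) ^ k) e) = ((s * φ ^ 3) ^ k) e)
    {v : ℤ × ℤ} {j : ℕ} (hv : translate s φ v = φ ^ j * (s * φ ^ 3) * (φ ^ j)⁻¹) (u : ℤ × ℤ) :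
    ∃ k : ℤ, (2 : ℤ) • (u - k • v) ∈ h.stabilizer d := by
  obtain ⟨k, hk⟩ := htight ((φ ^ j)⁻¹ (translate s φ u d))
  refine ⟨-k, ?_⟩
  rw [neg_smul, sub_neg_eq_add]
  have h1 : translate s φ (u + k • v) d =
      (φ ^ j) (((s * φ ^ 3) ^ k) ((φ ^ j)⁻¹ (translate s φ u d))) := by
    rw [add_comm, h.translate_add, h.translate_zsmul, hv, conj_zpow]
    rfl
  have h2 : (φ ^ 3) (translate s φ (u + k • v) d) = translate s φ (u + k • v) d := by
    rw [h1, ← mul_apply, ((Commute.refl φ).pow_pow 3 j).eq, mul_apply, hk]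
  rw [h.face_pow_three_translate, hd, h.translate_eq_iff] at h2
  rwa [two_zsmul, ← sub_neg_eq_add]

theorem card_of_tight [Finite D] (h : HexagonalRelations s φ) (hd : (φ ^ 3) d = d)
    (hφ : ∀ e, φ e ≠ e) (hs : ∀ e, s e ≠ e)
    (htrans : ∀ P : D → Prop, P d → (∀ e, P e → P (φ e)) → (∀ e, P e → P (s e)) → ∀ e, P e)
    (htight : ∀ e, ∃ k : ℤ, (φ ^ 3) (((s * φ ^ 3) ^ k) e) = ((s * φ ^ 3) ^ k) e) :
    ∃ m, Odd m ∧ Nat.card D = 3 * (4 * m) := by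
  have hcard := h.card_eq_three_mul_index hd hφ htrans
  have : Nonempty D := ⟨d⟩
  have : (h.stabilizer d).FiniteIndex := ⟨fun h0 => by
    rw [h0, mul_zero] at hcard
    exact Nat.card_pos.ne' hcard⟩
  obtain ⟨m, hm, hindex⟩ := index_of_halving (h.stabilizer d)
    (fun p hp => h.even_of_mem_stabilizer hd hs hp)
    (h.exists_halving hd htight translate_one_zero)
    (h.exists_halving hd htight translate_zero_one)
    (h.exists_halving hd htight h.translate_neg_one_one)
  exact ⟨m, hm, by rw [hcard, hindex]⟩

end HexagonalRelations

/-! ### From plane graphs to the lattice action. -/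

namespace RotationSystem

variable {V : Type*} {G : SimpleGraph V} (R : RotationSystem G)

theorem rot_eq : R.rot = R.faceNext * dartRev G := by
  ext1 d
  change R.rot d = R.rot (d.symm.symm)
  rw [SimpleGraph.Dart.symm_symm]

theorem acrossHexagon_eq (d : G.Dart) :
    R.acrossHexagon d = (dartRev G * R.faceNext ^ 3) d := rfl

variable [Finite V]

theorem rot_minimalPeriod (d : G.Dart) :
    minimalPeriod R.rot d = (G.neighborSet d.fst).ncard := by
  rw [minimalPeriod_eq_card_sameCycle, ← card_dart_fst]
  refine Nat.card_congr (Equiv.subtypeEquivRight fun e => ⟨?_, fun h => ?_⟩)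
  · have hpow : ∀ (n : ℕ), ((R.rot ^ n) d).fst = d.fst := fun n => by
      induction n with
      | zero => rfl
      | succ n ih => rw [pow_succ', mul_apply, R.rot_fst, ih]
    intro h
    obtain ⟨n, -, rfl⟩ := h.exists_pow_eq'
    exact hpow n
  · exact R.sameCycle_of_fst_eq d e h.symm

theorem hexagonalRelations (h3 : ∀ v : V, (G.neighborSet v).ncard = 3)
    (hface : ∀ d : G.Dart, R.faceSize d = 3 ∨ R.faceSize d = 6) :
    HexagonalRelations (dartRev G) R.faceNext where
  rev_sq := by
    ext1 d
    exact SimpleGraph.Dart.symm_symm d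
  face_pow := by
    ext1 d
    refine iterate_eq_self_of_minimalPeriod_dvd _ ?_
    change R.faceSize d ∣ 6
    rcases hface d with h | h <;> rw [h]
    exact ⟨2, rfl⟩
  vertex_pow := by
    rw [← rot_eq]
    ext1 d
    refine iterate_eq_self_of_minimalPeriod_dvd _ ?_
    rw [rot_minimalPeriod, h3]

/-- A set of darts of a connected graph which is closed under reversal and under face tracing
contains all darts if it contains one. -/
theorem dart_induction (hG : G.Connected) (P : G.Dart → Prop) (d : G.Dart) (hd : P d)
    (hface : ∀ e, P e → P (R.faceNext e)) (hrev : ∀ e, P e → P e.symm) (e : G.Dart) : P e := by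
  have hrot : ∀ e, P e → P (R.rot e) := fun e he => by
    rw [rot_eq]
    exact hface _ (hrev _ he)
  have hfst : ∀ e f : G.Dart, e.fst = f.fst → P e → P f := fun e f hef he => by
    obtain ⟨n, -, rfl⟩ := (R.sameCycle_of_fst_eq e f hef).exists_pow_eq'
    clear hef
    induction n with
    | zero => exact he
    | succ n ih =>
      rw [pow_succ', mul_apply]
      exact hrot _ ih
  obtain ⟨w⟩ := hG.preconnected d.fst e.fst
  have hwalk : ∀ (u v : V), G.Walk u v → (∀ e : G.Dart, e.fst = u → P e) →
      ∀ e : G.Dart, e.fst = v → P e := fun u v w => by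
    induction w with
    | nil => exact id
    | cons hadj _ ih =>
      intro hu
      refine ih fun e he => ?_
      exact hfst _ e he.symm (hrev _ (hu ⟨(_, _), hadj⟩ rfl))
  exact hwalk _ _ w (fun e he => hfst d e he.symm hd) e rfl

/-- With hexagons only, `3V = 2E = 6F`, so the Euler characteristic would be 0. -/
theorem exists_triangle (hplane : R.IsPlane) (h3 : ∀ v : V, (G.neighborSet v).ncard = 3)
    (hface : ∀ d : G.Dart, R.faceSize d = 3 ∨ R.faceSize d = 6) : ∃ d, R.faceSize d = 3 := by
  by_contra! hno
  have := Fintype.ofFinite G.Dart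
  have h6 : ∀ d, R.faceSize d = 6 := fun d => (hface d).resolve_left (hno d)
  have hsum := R.sum_inv_faceSize
  simp only [h6, Finset.sum_const, Finset.card_univ, ← Nat.card_eq_fintype_card,
    nsmul_eq_mul] at hsum
  have hE := card_dart_eq_two_mul_card_edgeSet (G := G)
  have hV := card_dart_of_threeValent h3
  have hF : Nat.card G.Dart = 6 * Nat.card R.Face := by
    have : (Nat.card G.Dart : ℚ) = 6 * Nat.card R.Face := by
      rw [← hsum]
      push_cast
      ring
    exact_mod_cast this
  have := hplane.2
  omega

/-- An orbit of `sφ³` that avoids triangles, indexed modulo its length, is a railroad. -/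
theorem exists_triangle_across (htight : R.Tight)
    (hface : ∀ d : G.Dart, R.faceSize d = 3 ∨ R.faceSize d = 6) (d : G.Dart) :
    ∃ k : ℕ, R.faceSize (((dartRev G * R.faceNext ^ 3) ^ k) d) = 3 := by
  by_contra! hno
  set a := dartRev G * R.faceNext ^ 3 with ha
  have hpos := minimalPeriod_perm_pos a d
  have : NeZero (minimalPeriod a d) := ⟨hpos.ne'⟩
  refine htight.false
    { length := minimalPeriod a d
      length_pos := hpos
      entry := fun i => (a ^ i.val) d
      entry_injective := fun i j hij => ?_
      hexagonal := fun i => (hface _).resolve_left (hno _)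
      entry_succ := fun i => ?_ }
  · refine ZMod.val_injective _ ?_
    refine iterate_injOn_Iio_minimalPeriod (ZMod.val_lt i) (ZMod.val_lt j) ?_
    simpa only [iterate_eq_pow] using hij
  · rw [acrossHexagon_eq, ← ha, ← mul_apply, ← pow_succ', ← iterate_eq_pow, ← iterate_eq_pow,
      ZMod.val_add, ZMod.val_one_eq_one_mod, Nat.add_mod_mod, iterate_mod_minimalPeriod_eq]

end RotationSystem

theorem IsType3.card_of_tight {V : Type*} [Finite V] {G : SimpleGraph V} {R : RotationSystem G}
    {n : ℕ} (h : IsType3 R n) (htight : R.Tight) : ∃ m, Odd m ∧ n = 4 * m := by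
  obtain ⟨d, hd⟩ := R.exists_triangle h.plane h.threeValent h.faceSize_eq
  have htri : ∀ e, R.faceSize e = 3 → (R.faceNext ^ 3) e = e := fun e he =>
    iterate_eq_self_of_minimalPeriod_dvd _ (Dvd.intro 1 (by rw [mul_one]; exact he))
  obtain ⟨m, hm, hcard⟩ := (R.hexagonalRelations h.threeValent h.faceSize_eq).card_of_tight
    (htri d hd)
    (fun e he => by
      have h1 : R.faceSize e = 1 := minimalPeriod_eq_one_iff_isFixedPt.2 he
      rcases h.faceSize_eq e with h' | h' <;> omega)
    (fun e => SimpleGraph.Dart.symm_ne e)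
    (fun P hP hface hrev => R.dart_induction h.plane.1 P d hP hface hrev)
    (fun e => by
      obtain ⟨k, hk⟩ := R.exists_triangle_across htight h.faceSize_eq e
      exact ⟨k, htri _ hk⟩)
  refine ⟨m, hm, ?_⟩
  rw [card_dart_of_threeValent h.threeValent, h.card_vertices] at hcard
  omega

/-! ### The vertices of the tight graph and its Hamiltonian circuits. -/

/-- The vertices of the tight graph with `4 * m` vertices. -/
abbrev TightVertex (m : ℕ) : Type := ZMod m × ZMod 2 × ZMod 2

namespace TightVertex

variable (m : ℕ)

/-- The sum of the two ends of an edge of the given colour. -/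
def edgeSum : Fin 3 → TightVertex m :=
  ![(0, (1, 1)), (1, (1, 0)), (-1, (0, 1))]

theorem edgeSum_snd (i : Fin 3) : (edgeSum m i).2 = ![(1, 1), (1, 0), (0, 1)] i := by
  fin_cases i <;> rfl

theorem edgeSum_fst (i : Fin 3) : (edgeSum m i).1 = ![0, 1, -1] i := by
  fin_cases i <;> rfl

variable {m}

/-- The other end of the edge of colour `i` at `x`. -/
def neighbor (i : Fin 3) (x : TightVertex m) : TightVertex m := edgeSum m i - x

@[simp]
theorem neighbor_neighbor (i : Fin 3) (x : TightVertex m) : neighbor i (neighbor i x) = x :=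
  sub_sub_cancel _ _

theorem neighbor_ne (i : Fin 3) (x : TightVertex m) : neighbor i x ≠ x := by
  intro h
  have h2 : (edgeSum m i).2 - x.2 = x.2 := congrArg Prod.snd h
  rw [edgeSum_snd] at h2
  revert h2
  generalize x.2 = v
  revert v
  fin_cases i <;> decide

theorem neighbor_injective (x : TightVertex m) : Injective fun i => neighbor i x := by
  intro i j h
  have h2 : (edgeSum m i).2 = (edgeSum m j).2 := congrArg Prod.snd (sub_left_injective h)
  rw [edgeSum_snd, edgeSum_snd] at h2
  clear h
  revert i j
  decide

theorem isUnit_two (hm : Odd m) : IsUnit (2 : ZMod m) := by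
  have := (ZMod.isUnit_iff_coprime 2 m).2 (Nat.coprime_two_left.2 hm)
  simpa using this

theorem isUnit_edgeSum_sub_fst (hm : Odd m) {i j : Fin 3} (hij : i ≠ j) :
    IsUnit (edgeSum m i - edgeSum m j).1 := by
  have h2 := isUnit_two hm
  have h2' : IsUnit (-2 : ZMod m) := h2.neg
  rw [Prod.fst_sub, edgeSum_fst, edgeSum_fst]
  revert hij
  fin_cases i <;> fin_cases j <;> intro hij <;> first
    | exact absurd rfl hij
    | (norm_num; done)
    | (norm_num; assumption)

/-- The vertices along the closed walk with edges alternately of colours `i` and `j`. -/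
def alternate (i j : Fin 3) (p : TightVertex m) : ℕ → TightVertex m
  | 0 => p
  | n + 1 => neighbor (if Even n then i else j) (alternate i j p n)

theorem alternate_two_mul (i j : Fin 3) (p : TightVertex m) (k : ℕ) :
    alternate i j p (2 * k) = p + k • (edgeSum m j - edgeSum m i) := by
  induction k with
  | zero => simp [alternate]
  | succ k ih =>
    have h : ¬ Even (2 * k + 1) := by simp
    rw [mul_add, mul_one, alternate, alternate, if_neg h, if_pos (even_two_mul k), ih, neighbor, neighbor,
      succ_nsmul]
    abel

theorem exists_nsmul_eq [NeZero m] (hm : Odd m) {e y : TightVertex m} (he : IsUnit e.1)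
    (hy : y.2 = 0 ∨ y.2 = e.2) : ∃ k < 2 * m, k • e = y := by
  obtain ⟨u, hu⟩ := he
  let k := (y.1 * ((u⁻¹ : (ZMod m)ˣ) : ZMod m)).val
  have hk : k < m := ZMod.val_lt _
  have h1 : ∀ l : ℕ, l = k ∨ l = k + m → l • e.1 = y.1 := by
    intro l hl
    have : (l : ZMod m) = y.1 * ((u⁻¹ : (ZMod m)ˣ) : ZMod m) := by
      rcases hl with rfl | rfl <;> simp [k]
    rw [nsmul_eq_mul, this, ← hu, Units.inv_mul_cancel_right]
  -- The first coordinate fixes the multiplier modulo `m`, the second only its parity; `m` is odd,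
  -- so `k` and `k + m` have different parities.
  have h2 : ∃ l, (l = k ∨ l = k + m) ∧ l • e.2 = y.2 := by
    have h20 : ∀ v : ZMod 2 × ZMod 2, 2 • v = 0 := by decide
    have heven : ∀ l : ℕ, Even l → l • e.2 = 0 := by
      rintro l ⟨r, rfl⟩
      rw [← two_mul, mul_comm, mul_smul, h20, smul_zero]
    have hodd : ∀ l : ℕ, Odd l → l • e.2 = e.2 := by
      rintro l ⟨r, rfl⟩
      rw [succ_nsmul, heven _ (even_two_mul r), zero_add]
    rcases Nat.even_or_odd k with hk | hk
    · rcases hy with hy | hy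
      · exact ⟨k, .inl rfl, by rw [heven _ hk, hy]⟩
      · exact ⟨k + m, .inr rfl, by rw [hodd _ (hk.add_odd hm), hy]⟩
    · rcases hy with hy | hy
      · exact ⟨k + m, .inr rfl, by rw [heven _ (hk.add_odd hm), hy]⟩
      · exact ⟨k, .inl rfl, by rw [hodd _ hk, hy]⟩
  obtain ⟨l, hl, hle⟩ := h2
  exact ⟨l, by omega, Prod.ext (h1 l hl) hle⟩

/-- Even steps reach the coset of `p` under the multiples of `e_j - e_i`, a subgroup of index 2; odd
steps reach the other coset, because the `(ℤ/2)²`-part of `e_i` is outside the subgroup. -/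
theorem exists_alternate_eq [NeZero m] (hm : Odd m) {i j : Fin 3} (hij : i ≠ j)
    (p x : TightVertex m) : ∃ n < 4 * m, alternate i j p n = x := by
  have he := isUnit_edgeSum_sub_fst hm hij.symm
  have hcases : ((x - p).2 = 0 ∨ (x - p).2 = (edgeSum m j - edgeSum m i).2) ∨
      ((neighbor i x - p).2 = 0 ∨ (neighbor i x - p).2 = (edgeSum m j - edgeSum m i).2) := by
    simp only [neighbor, Prod.snd_sub, edgeSum_snd]
    generalize x.2 = v
    generalize p.2 = w
    clear he
    revert i j v w
    decide
  rcases hcases with h | h <;> obtain ⟨k, hk, hke⟩ := exists_nsmul_eq hm he h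
  · exact ⟨2 * k, by omega, by rw [alternate_two_mul, hke, add_sub_cancel]⟩
  · refine ⟨2 * k + 1, by omega, ?_⟩
    rw [alternate, if_pos (even_two_mul k), alternate_two_mul, hke, add_sub_cancel, neighbor_neighbor]

theorem card_eq [NeZero m] : Nat.card (TightVertex m) = 4 * m := by
  simp [mul_comm]

theorem alternate_injOn [NeZero m] (hm : Odd m) {i j : Fin 3} (hij : i ≠ j)
    (p : TightVertex m) : Set.InjOn (alternate i j p) (Set.Iio (4 * m)) := by
  let f : Fin (4 * m) → TightVertex m := fun n => alternate i j p n
  have hf : Surjective f := fun x => by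
    obtain ⟨n, hn, hx⟩ := exists_alternate_eq hm hij p x
    exact ⟨⟨n, hn⟩, hx⟩
  have hcard : Fintype.card (Fin (4 * m)) = Fintype.card (TightVertex m) := by
    rw [← Nat.card_eq_fintype_card (α := TightVertex m), card_eq, Fintype.card_fin]
  have hinj := ((Fintype.bijective_iff_surjective_and_card f).2 ⟨hf, hcard⟩).1
  intro a ha b hb hab
  exact congrArg Fin.val (@hinj ⟨a, ha⟩ ⟨b, hb⟩ hab)

theorem alternate_period [NeZero m] (i j : Fin 3) (p : TightVertex m) :
    alternate i j p (4 * m) = p := by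
  have h20 : ∀ v : ZMod 2 × ZMod 2, 2 • v = 0 := by decide
  rw [show 4 * m = 2 * (2 * m) by ring, alternate_two_mul, add_eq_left]
  ext1
  · rw [Prod.smul_fst, nsmul_eq_mul]
    simp
  · rw [Prod.smul_snd, mul_comm, mul_smul, h20, smul_zero]
    rfl

theorem alternate_pred_period [NeZero m] (i j : Fin 3) (p : TightVertex m) :
    alternate i j p (4 * m - 1) = neighbor j p := by
  have hpos := NeZero.pos m
  have h := alternate_period i j p
  have hodd : ¬ Even (4 * m - 1) := by
    rw [Nat.not_even_iff_odd]
    exact ⟨2 * m - 1, by omega⟩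
  rw [show 4 * m = 4 * m - 1 + 1 by omega, alternate, if_neg hodd] at h
  conv_rhs => rw [← h, neighbor_neighbor]

end TightVertex

open TightVertex

/-! ### The tight graph is 3-connected. -/

/-- The tight graph with `4 * m` vertices: its three classes of parallel edges join the vertices
with a given sum. -/
def tightGraph (m : ℕ) : SimpleGraph (TightVertex m) where
  Adj x y := ∃ i, neighbor i x = y
  symm := ⟨by
    rintro x _ ⟨i, rfl⟩
    exact ⟨i, neighbor_neighbor i x⟩⟩
  loopless := ⟨fun x ⟨i, hi⟩ => neighbor_ne i x hi⟩

namespace tightGraph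

variable {m : ℕ}

theorem adj_neighbor (i : Fin 3) (x : TightVertex m) : (tightGraph m).Adj x (neighbor i x) := ⟨i, rfl⟩

theorem reachable_induce_of_path {V : Type*} {G : SimpleGraph V} {S : Set V} {w : ℕ → V}
    (hadj : ∀ k, G.Adj (w k) (w (k + 1))) {a b : ℕ} (hab : a ≤ b)
    (hS : ∀ k, a ≤ k → k ≤ b → w k ∈ Sᶜ) :
    (G.induce Sᶜ).Reachable ⟨w a, hS a le_rfl hab⟩ ⟨w b, hS b hab le_rfl⟩ := by
  induction b, hab using Nat.le_induction with
  | base => rfl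
  | succ b hab ih =>
    refine (ih fun k h1 h2 => hS k h1 (h2.trans b.le_succ)).trans ?_
    exact SimpleGraph.Adj.reachable (hadj b)

/-- Every vertex off `S ⊆ {p, q}` is joined off `S` to one of the first and last vertices of
the Hamiltonian circuit from `p` with alternating colours. -/
theorem reachable_neighbor_or [NeZero m] (hm : Odd m) {S : Set (TightVertex m)}
    {p q : TightVertex m} (hp : p ∈ S) (hS : S ⊆ {p, q}) {i j : Fin 3} (hij : i ≠ j)
    {x : TightVertex m} (hx : x ∈ Sᶜ) :
    (∃ h : neighbor i p ∈ Sᶜ, ((tightGraph m).induce Sᶜ).Reachable ⟨x, hx⟩ ⟨neighbor i p, h⟩) ∨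
      ∃ h : neighbor j p ∈ Sᶜ, ((tightGraph m).induce Sᶜ).Reachable ⟨x, hx⟩ ⟨neighbor j p, h⟩ := by
  have hadj : ∀ k, (tightGraph m).Adj (alternate i j p k) (alternate i j p (k + 1)) :=
    fun k => adj_neighbor _ _
  have hinj := alternate_injOn hm hij p
  obtain ⟨n, hn, rfl⟩ := exists_alternate_eq hm hij p x
  have hn0 : n ≠ 0 := by
    rintro rfl
    exact hx hp
  have h1 : alternate i j p 1 = neighbor i p := by simp [alternate]
  by_cases hleft : ∀ k, 1 ≤ k → k ≤ n → alternate i j p k ∈ Sᶜ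
  · have := reachable_induce_of_path hadj (Nat.one_le_iff_ne_zero.2 hn0) hleft
    left
    simp only [h1] at this
    exact ⟨_, this.symm⟩
  · push Not at hleft
    obtain ⟨k, hk1, hkn, hk⟩ := hleft
    rw [Set.mem_compl_iff, not_not] at hk
    have hp0 : ∀ l, l ≠ 0 → l < 4 * m → alternate i j p l ≠ p := fun l hl0 hl hlp =>
      hl0 (hinj hl (Nat.pos_of_ne_zero fun h => by omega) hlp)
    have hkq : alternate i j p k = q := (hS hk).resolve_left (hp0 k (by omega) (by omega))
    -- The path left by removing `p` meets `S` at most once more, at `q`; as `q` lies before `x`,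
    -- the rest of the path is free.
    have hright : ∀ l, n ≤ l → l ≤ 4 * m - 1 → alternate i j p l ∈ Sᶜ := by
      intro l hnl hl hlS
      have hlq := (hS hlS).resolve_left (hp0 l (by omega) (by omega))
      have hlk : l = k := hinj (show l < 4 * m by omega)
        (show k < 4 * m by omega) (hlq.trans hkq.symm)
      obtain rfl : n = k := by omega
      exact hx hk
    have := reachable_induce_of_path hadj (show n ≤ 4 * m - 1 by omega) hright
    right
    simp only [alternate_pred_period] at this
    exact ⟨_, this⟩

theorem induce_compl_preconnected [NeZero m] (hm : Odd m) {S : Set (TightVertex m)}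
    {p q : TightVertex m} (hp : p ∈ S) (hS : S ⊆ {p, q}) :
    ((tightGraph m).induce Sᶜ).Preconnected := by
  intro a b
  suffices h : ∃ y, ∀ x, ((tightGraph m).induce Sᶜ).Reachable x y by
    obtain ⟨y, hy⟩ := h
    exact (hy a).trans (hy b).symm
  have key : ∀ (i j : Fin 3), i ≠ j → ∀ x : (Sᶜ : Set (TightVertex m)), _ :=
    fun i j hij x => reachable_neighbor_or hm hp hS hij x.2
  -- If the neighbour of colour 2 survives, colours 0 and 1 connect it to another surviving
  -- neighbour, and the circuit using 2 and that colour then gathers all vertices. Otherwise colours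
  -- 0 and 2 lead everything to the neighbour of colour 0.
  by_cases h2 : neighbor 2 p ∈ Sᶜ
  · rcases key 0 1 (by decide) ⟨_, h2⟩ with ⟨h0, hr⟩ | ⟨h1, hr⟩
    · refine ⟨⟨_, h0⟩, fun x => ?_⟩
      rcases key 0 2 (by decide) x with ⟨_, h⟩ | ⟨_, h⟩
      · exact h
      · exact h.trans hr
    · refine ⟨⟨_, h1⟩, fun x => ?_⟩
      rcases key 1 2 (by decide) x with ⟨_, h⟩ | ⟨_, h⟩
      · exact h
      · exact h.trans hr
  · by_cases h0 : neighbor 0 p ∈ Sᶜ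
    · refine ⟨⟨_, h0⟩, fun x => ?_⟩
      rcases key 0 2 (by decide) x with ⟨_, h⟩ | ⟨h, _⟩
      · exact h
      · exact absurd h h2
    · rcases key 0 2 (by decide) a with ⟨h, _⟩ | ⟨h, _⟩
      · exact absurd h h0
      · exact absurd h h2

theorem threeConnected [NeZero m] (hm : Odd m) : ThreeConnected (tightGraph m) := by
  have hpos := NeZero.pos m
  refine ⟨by rw [card_eq]; omega, fun S hS => ?_⟩
  have hne : Nonempty (Sᶜ : Set (TightVertex m)) := by
    by_contra hempty
    have hall : S = Set.univ := Set.compl_empty_iff.1 (Set.not_nonempty_iff_eq_empty.1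
      fun h => hempty h.to_subtype)
    rw [hall, Set.ncard_univ, card_eq] at hS
    omega
  refine { preconnected := ?_, nonempty := hne }
  rcases S.eq_empty_or_nonempty with rfl | ⟨p, hp⟩
  · intro ⟨x, hx⟩ ⟨y, hy⟩
    obtain ⟨n, -, rfl⟩ := exists_alternate_eq hm (i := 0) (j := 1) (by decide) x y
    exact reachable_induce_of_path (w := alternate 0 1 x) (fun k => adj_neighbor _ _) (Nat.zero_le n)
      fun k _ _ => Set.notMem_empty _
  · have h1 : (S \ {p}).ncard ≤ 1 := by
      have := Set.ncard_sdiff_singleton_add_one hp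
      omega
    obtain ⟨q, hq⟩ := (Set.ncard_le_one_iff_subset_singleton).1 h1
    refine induce_compl_preconnected hm hp (q := q) fun x hx => ?_
    by_cases hxp : x = p
    · exact .inl hxp
    · exact .inr (hq ⟨hx, hxp⟩)

theorem connected [NeZero m] (hm : Odd m) : (tightGraph m).Connected := by
  have h := (threeConnected hm).2 ∅ (by simp)
  refine { preconnected := fun x y => ?_, nonempty := inferInstance }
  have := h.preconnected ⟨x, Set.notMem_empty x⟩ ⟨y, Set.notMem_empty y⟩
  exact this.map (SimpleGraph.Embedding.induce _).toHom

theorem threeValent (x : TightVertex m) : ((tightGraph m).neighborSet x).ncard = 3 := by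
  have : (tightGraph m).neighborSet x = (fun i => neighbor i x) '' Set.univ := by
    ext y
    simp [SimpleGraph.neighborSet, tightGraph]
  rw [this, Set.ncard_image_of_injective _ (neighbor_injective x), Set.ncard_univ, Nat.card_fin]

/-! ### The plane drawing, its faces and its tightness. -/

/-- The darts of the tight graph, given by their start vertex and their colour. -/
noncomputable def dartEquiv (m : ℕ) : TightVertex m × Fin 3 ≃ (tightGraph m).Dart :=
  Equiv.ofBijective (fun z => ⟨(z.1, neighbor z.2 z.1), adj_neighbor _ _⟩) <| by
    constructor
    · rintro ⟨x, i⟩ ⟨y, j⟩ h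
      have h' := congrArg SimpleGraph.Dart.toProd h
      obtain rfl : x = y := congrArg Prod.fst h'
      obtain rfl : i = j := neighbor_injective x (congrArg Prod.snd h')
      rfl
    · rintro ⟨⟨x, y⟩, i, hi⟩
      exact ⟨(x, i), SimpleGraph.Dart.ext _ _ (Prod.ext rfl hi)⟩

theorem dartEquiv_symm (x : TightVertex m) (i : Fin 3) :
    (dartEquiv m (x, i)).symm = dartEquiv m (neighbor i x, i) := by
  apply SimpleGraph.Dart.ext
  change (neighbor i x, x) = (neighbor i x, neighbor i (neighbor i x))
  rw [neighbor_neighbor]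

/-- The drawing of the tight graph in which the colours have the same cyclic order around every
vertex. -/
noncomputable def rotation (m : ℕ) : RotationSystem (tightGraph m) where
  rot := (dartEquiv m).permCongr ((Equiv.refl _).prodCongr (Equiv.addRight 1))
  rot_fst d := by
    obtain ⟨⟨x, i⟩, rfl⟩ := (dartEquiv m).surjective d
    rw [Equiv.permCongr_apply, Equiv.symm_apply_apply]
    rfl
  sameCycle_of_fst_eq d e h := by
    obtain ⟨⟨x, i⟩, rfl⟩ := (dartEquiv m).surjective d
    obtain ⟨⟨y, j⟩, rfl⟩ := (dartEquiv m).surjective e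
    obtain rfl : x = y := h
    generalize hr : (dartEquiv m).permCongr ((Equiv.refl _).prodCongr (Equiv.addRight 1)) = r
    have hstep : ∀ i, r (dartEquiv m (x, i)) = dartEquiv m (x, i + 1) := fun i => by
      rw [← hr, Equiv.permCongr_apply, Equiv.symm_apply_apply]
      rfl
    have hpow : ∀ n : ℕ, (r ^ n) (dartEquiv m (x, i)) = dartEquiv m (x, i + n • 1) := by
      intro n
      induction n with
      | zero => simp
      | succ n ih => rw [pow_succ', mul_apply, ih, hstep, succ_nsmul, add_assoc]
    refine ⟨((j - i).val : ℕ), ?_⟩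
    have hij : ∀ i j : Fin 3, i + (j - i).val • (1 : Fin 3) = j := by decide
    rw [zpow_natCast, hpow, hij]

theorem rotation_rot (x : TightVertex m) (i : Fin 3) :
    (rotation m).rot (dartEquiv m (x, i)) = dartEquiv m (x, i + 1) := by
  change (dartEquiv m).permCongr _ (dartEquiv m (x, i)) = _
  rw [Equiv.permCongr_apply, Equiv.symm_apply_apply]
  rfl

theorem faceNext_dartEquiv (x : TightVertex m) (i : Fin 3) :
    (rotation m).faceNext (dartEquiv m (x, i)) = dartEquiv m (neighbor i x, i + 1) := by
  change (rotation m).rot (dartEquiv m (x, i)).symm = _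
  rw [dartEquiv_symm, rotation_rot]

/-- The sum of a vertex of a hexagon and the opposite vertex. -/
def faceSum (m : ℕ) (i : Fin 3) : TightVertex m :=
  edgeSum m (i + 2) - edgeSum m (i + 1) + edgeSum m i

theorem faceSum_snd (i : Fin 3) : (faceSum m i).2 = 0 := by
  rw [faceSum, Prod.snd_add, Prod.snd_sub, edgeSum_snd, edgeSum_snd, edgeSum_snd]
  revert i
  decide

theorem faceNext_pow_three (x : TightVertex m) (i : Fin 3) :
    ((rotation m).faceNext ^ 3) (dartEquiv m (x, i)) = dartEquiv m (faceSum m i - x, i) := by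
  simp only [pow_succ, pow_zero, one_mul, mul_apply, faceNext_dartEquiv]
  congr 2
  · have h2 : i + 1 + 1 = i + 2 := by
      revert i
      decide
    simp only [neighbor, faceSum, h2]
    abel
  · revert i
    decide

theorem faceNext_pow_three_eq_iff (x : TightVertex m) (i : Fin 3) :
    ((rotation m).faceNext ^ 3) (dartEquiv m (x, i)) = dartEquiv m (x, i) ↔
      2 * x.1 = (faceSum m i).1 := by
  rw [faceNext_pow_three, EmbeddingLike.apply_eq_iff_eq, Prod.ext_iff, Prod.ext_iff,
    Prod.snd_sub, faceSum_snd, Prod.fst_sub]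
  have h : ∀ v : ZMod 2 × ZMod 2, 0 - v = v := by decide
  simp only [h, and_true, sub_eq_iff_eq_add, two_mul]
  exact eq_comm

/-- Each face step raises the colour by 1 modulo 3, which excludes the divisors 1 and 2 of 6. The
third step is the reflection `x ↦ faceSum m i - x`, which decides between 3 and 6. -/
theorem faceSize_eq_ite (x : TightVertex m) (i : Fin 3) :
    (rotation m).faceSize (dartEquiv m (x, i)) = if 2 * x.1 = (faceSum m i).1 then 3 else 6 := by
  have h1 : ¬ IsPeriodicPt (rotation m).faceNext 2 (dartEquiv m (x, i)) := fun h => by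
    have h' : dartEquiv m (neighbor (i + 1) (neighbor i x), i + 1 + 1) = dartEquiv m (x, i) := by
      rw [← faceNext_dartEquiv, ← faceNext_dartEquiv]
      exact h
    have h2 : i + 1 + 1 = i := congrArg Prod.snd ((dartEquiv m).injective h')
    clear h h'
    revert i
    decide
  have h2 : (rotation m).faceSize (dartEquiv m (x, i)) ∣ 6 := by
    refine IsPeriodicPt.minimalPeriod_dvd ?_
    rw [IsPeriodicPt, IsFixedPt, iterate_eq_pow, show 6 = 3 + 3 from rfl, pow_add, mul_apply,
      faceNext_pow_three, faceNext_pow_three, sub_sub_cancel]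
  have h3 : (rotation m).faceSize (dartEquiv m (x, i)) ∣ 3 ↔ 2 * x.1 = (faceSum m i).1 := by
    rw [← faceNext_pow_three_eq_iff, RotationSystem.faceSize, ← isPeriodicPt_iff_minimalPeriod_dvd,
      IsPeriodicPt, IsFixedPt, iterate_eq_pow]
  rw [isPeriodicPt_iff_minimalPeriod_dvd] at h1
  change ¬ (rotation m).faceSize (dartEquiv m (x, i)) ∣ 2 at h1
  generalize (rotation m).faceSize (dartEquiv m (x, i)) = n at *
  have hn := Nat.le_of_dvd (by norm_num) h2
  split_ifs with h
  · have := h3.2 h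
    interval_cases n <;> omega
  · have := mt h3.1 h
    interval_cases n <;> omega

theorem faceSize_eq (d : (tightGraph m).Dart) :
    (rotation m).faceSize d = 3 ∨ (rotation m).faceSize d = 6 := by
  obtain ⟨⟨x, i⟩, rfl⟩ := (dartEquiv m).surjective d
  rw [faceSize_eq_ite]
  split_ifs <;> simp

theorem card_triangle_darts (hm : Odd m) :
    Nat.card {z : TightVertex m × Fin 3 // 2 * z.1.1 = (faceSum m z.2).1} = 12 := by
  obtain ⟨u, hu⟩ := isUnit_two hm
  let e : {z : TightVertex m × Fin 3 // 2 * z.1.1 = (faceSum m z.2).1} ≃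
      (ZMod 2 × ZMod 2) × Fin 3 :=
    { toFun := fun z => (z.1.1.2, z.1.2)
      invFun := fun y => ⟨(((↑u⁻¹ : ZMod m) * (faceSum m y.2).1, y.1), y.2), by
        rw [← hu, Units.mul_inv_cancel_left]⟩
      left_inv := by
        rintro ⟨⟨⟨t, v⟩, i⟩, h⟩
        have h' : (↑u⁻¹ : ZMod m) * (faceSum m i).1 = t := by
          rw [← h, ← hu, Units.inv_mul_cancel_left]
        simp only [h']
      right_inv := fun y => rfl }
  rw [Nat.card_congr e]
  simp

theorem card_face [NeZero m] (hm : Odd m) : Nat.card (rotation m).Face = 2 * m + 2 := by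
  classical
  have := Fintype.ofFinite (tightGraph m).Dart
  have h := (rotation m).sum_inv_faceSize
  rw [← (dartEquiv m).sum_comp] at h
  -- As `1/3 = 1/6 + 1/6`, the `12m` darts contribute `2m` and the 12 darts on triangles a further
  -- 2.
  have hterm : ∀ z : TightVertex m × Fin 3, (1 / (rotation m).faceSize (dartEquiv m z) : ℚ) =
      1 / 6 + if 2 * z.1.1 = (faceSum m z.2).1 then 1 / 6 else 0 := fun ⟨x, i⟩ => by
    rw [faceSize_eq_ite]
    split_ifs <;> norm_num
  simp only [hterm] at h
  rw [Finset.sum_add_distrib, ← Finset.sum_filter, Finset.sum_const, Finset.sum_const,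
    ← Fintype.card_subtype, ← Nat.card_eq_fintype_card, card_triangle_darts hm, Finset.card_univ,
    ← Nat.card_eq_fintype_card, Nat.card_prod, TightVertex.card_eq, Nat.card_fin] at h
  have h' : (2 * m + 2 : ℚ) = Nat.card (rotation m).Face := by
    rw [← h]
    push_cast [nsmul_eq_mul]
    ring
  exact_mod_cast h'.symm

theorem isPlane [NeZero m] (hm : Odd m) : (rotation m).IsPlane := by
  refine ⟨connected hm, ?_⟩
  have hE := card_dart_eq_two_mul_card_edgeSet (G := tightGraph m)
  rw [card_dart_of_threeValent threeValent, TightVertex.card_eq] at hE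
  rw [card_face hm, TightVertex.card_eq]
  push_cast
  omega

theorem isType3 [NeZero m] (hm : Odd m) : IsType3 (rotation m) (4 * m) where
  card_vertices := TightVertex.card_eq
  plane := isPlane hm
  threeConnected := threeConnected hm
  threeValent := threeValent
  faceSize_eq := faceSize_eq

theorem acrossHexagon_dartEquiv (x : TightVertex m) (i : Fin 3) :
    (rotation m).acrossHexagon (dartEquiv m (x, i)) =
      dartEquiv m (x + (edgeSum m (i + 1) - edgeSum m (i + 2)), i) := by
  change (((rotation m).faceNext ^ 3) (dartEquiv m (x, i))).symm = _
  rw [faceNext_pow_three, dartEquiv_symm, neighbor, faceSum]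
  congr 2
  abel

theorem tight [NeZero m] (hm : Odd m) : (rotation m).Tight := by
  refine ⟨fun r => ?_⟩
  obtain ⟨⟨x, i⟩, hx⟩ := (dartEquiv m).surjective (r.entry 0)
  have hi : i + 1 ≠ i + 2 := by
    clear hx
    revert i
    decide
  obtain ⟨u, hu⟩ := isUnit_edgeSum_sub_fst hm hi
  obtain ⟨v, hv⟩ := isUnit_two hm
  have hentry : ∀ n : ℕ, r.entry n =
      dartEquiv m (x + n • (edgeSum m (i + 1) - edgeSum m (i + 2)), i) := fun n => by
    induction n with
    | zero => simp [hx]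
    | succ n ih =>
      rw [Nat.cast_succ, r.entry_succ, ih, acrossHexagon_dartEquiv, succ_nsmul, add_assoc]
  -- The solution of `2 (x.1 + k u) = (faceSum m i).1`, where `u` is the first coordinate of one
  -- step straight ahead.
  let k : ZMod m := ((↑v⁻¹ : ZMod m) * (faceSum m i).1 - x.1) * (↑u⁻¹ : ZMod m)
  have h := r.hexagonal (k.val : ℕ)
  have htri : 2 * (x + k.val • (edgeSum m (i + 1) - edgeSum m (i + 2))).1 = (faceSum m i).1 := by
    rw [Prod.fst_add, Prod.smul_fst, ← hu, nsmul_eq_mul, ZMod.natCast_zmod_val,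
      Units.inv_mul_cancel_right, add_sub_cancel, ← hv, Units.mul_inv_cancel_left]
  rw [hentry, faceSize_eq_ite, if_pos htri] at h
  omega

end tightGraph

end PlaneGraph

theorem theorem5p7 (n : ℕ) :
    (∃ (V : Type) (_ : Finite V) (G : SimpleGraph V) (R : PlaneGraph.RotationSystem G),
        PlaneGraph.IsType3 R n ∧ R.Tight) ↔
      4 ∣ n ∧ Odd (n / 4) := by
  constructor
  · rintro ⟨V, _, G, R, hR, htight⟩
    obtain ⟨m, hm, rfl⟩ := hR.card_of_tight htight
    exact ⟨Dvd.intro m rfl, by rwa [Nat.mul_div_cancel_left m four_pos]⟩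
  · rintro ⟨⟨m, rfl⟩, hm⟩
    rw [Nat.mul_div_cancel_left m four_pos] at hm
    have : NeZero m := ⟨hm.pos.ne'⟩
    exact ⟨PlaneGraph.TightVertex m, inferInstance, PlaneGraph.tightGraph m,
      PlaneGraph.tightGraph.rotation m, PlaneGraph.tightGraph.isType3 hm,
      PlaneGraph.tightGraph.tight hm⟩
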